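/- Let $K$ be a field. Let $\mathcal{T}$ be the $K$-vector space with basis the isomorphism classes of finite (non-planar, non-empty) rooted trees, and let $\mathcal{T}'$ be the $K$-vector space with basis those rooted trees that have at least one edge. For rooted trees $u,v$ put $$u\rightarrow v=\sum_{x} N(u,v,x)\,x ,$$ where $x$ runs over the rooted trees and $N(u,v,x)$ is the number of edges $e$ of $x$ such that, after deletion of $e$, the component of $x$ not containing the root (rooted at the lower end of $e$) is isomorphic to $u$ and the component containing the root is isomorphic to $v$. For a rooted tree $t$ with at least one edge and a rooted tree $u$ put $$t\vartriangleright u=\sum_{x}\mathcal{N}(t,u,x)\,x ,$$ where $\mathcal{N}(t,u,x)$ is the number of subtrees $s$ of $x$ (connected sets of vertices, rooted at their vertex nearest to the root of $x$) that are isomorphic to $t$ and for which the tree $x/s$, obtained from $x$ by contracting $s$ to a single vertex, is isomorphic to $u$. These sums are finite; extend $\rightarrow$ bilinearly to $\mathcal{T}\times\mathcal{T}\to\mathcal{T}$ and $\vartriangleright$ bilinearly to $\mathcal{T}'\times\mathcal{T}\to\mathcal{T}$. Then for all $t\in\mathcal{T}'$ and $u,v\in\mathcal{T}$, $$t\vartriangleright(u\rightarrow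 v)=(t\vartriangleright u)\rightarrow v+u\rightarrow(t\vartriangleright v).$$ -/

import Mathlib

/-- A rooted tree with vertex set `V`, given by its root and by the map that sends every vertex
other than the root to its parent (the next vertex on the path to the root). The edges are the
pairs `{v, parent v}` with `v ≠ root`, so edges correspond to the vertices other than the root.
The value `parent root = root` is a convention; every vertex is joined to the root. -/
structure RootedTreeOn (V : Type) where
  root : V
  parent : V → V
  parent_root : parent root = root
  exists_iterate : ∀ v, ∃ k, parent^[k] v = root

namespace RootedTreeOn

variable {V W : Type}

/-- Isomorphism of rooted trees: a bijection of the vertices that preserves the root and the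
parent relation. -/
def Iso (x : RootedTreeOn V) (y : RootedTreeOn W) : Prop :=
  ∃ e : V ≃ W, e x.root = y.root ∧ ∀ v, e (x.parent v) = y.parent (e v)

theorem Iso.refl (x : RootedTreeOn V) : x.Iso x :=
  ⟨Equiv.refl V, rfl, fun _ => rfl⟩

theorem Iso.symm {x : RootedTreeOn V} {y : RootedTreeOn W} : x.Iso y → y.Iso x := by
  rintro ⟨e, h1, h2⟩
  refine ⟨e.symm, by rw [← h1, e.symm_apply_apply], fun w => ?_⟩
  rw [e.symm_apply_eq, h2, e.apply_symm_apply]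

theorem Iso.trans {U : Type} {x : RootedTreeOn V} {y : RootedTreeOn W} {z : RootedTreeOn U} :
    x.Iso y → y.Iso z → x.Iso z := by
  rintro ⟨e, h1, h2⟩ ⟨f, g1, g2⟩
  exact ⟨e.trans f, by simp [h1, g1], fun v => by simp [h2, g2]⟩

theorem Iso.card_eq {x : RootedTreeOn V} {y : RootedTreeOn W} (h : x.Iso y) :
    Nat.card V = Nat.card W := by
  obtain ⟨e, -⟩ := h
  exact Nat.card_congr e

theorem iterate_root (x : RootedTreeOn V) (k : ℕ) : x.parent^[k] x.root = x.root :=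
  Function.iterate_fixed x.parent_root k

/-- A subtree of a rooted tree, i.e. a nonempty connected set of vertices with all the edges of
the tree between them: it has a vertex `top` (its vertex nearest to the root), and the path going
up from any of its vertices reaches `top` without leaving the set. -/
structure Subtree (x : RootedTreeOn V) where
  carrier : Set V
  top : V
  top_mem : top ∈ carrier
  exists_path : ∀ v ∈ carrier, ∃ k, x.parent^[k] v = top ∧ ∀ j ≤ k, x.parent^[j] v ∈ carrier

namespace Subtree

variable {x : RootedTreeOn V}

theorem parent_mem (s : x.Subtree) {v : V} (hv : v ∈ s.carrier) (h : v ≠ s.top) :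
    x.parent v ∈ s.carrier := by
  obtain ⟨k, hk, hj⟩ := s.exists_path v hv
  rcases k with _ | k
  · exact absurd hk h
  · exact hj 1 (by omega)

theorem top_eq_root (s : x.Subtree) (h : x.root ∈ s.carrier) : s.top = x.root := by
  obtain ⟨k, hk, -⟩ := s.exists_path _ h
  rw [← hk, x.iterate_root]

/-- If a vertex lies on a closed path going up, it is the root. -/
theorem eq_root_of_cycle (x : RootedTreeOn V) {v : V} {k : ℕ} (h : x.parent^[k + 1] v = v) :
    v = x.root := by
  obtain ⟨m, hm⟩ := x.exists_iterate v
  have h1 : (x.parent^[k + 1])^[m] v = v := Function.iterate_fixed h m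
  rw [← Function.iterate_mul, show (k + 1) * m = k * m + m by ring,
    Function.iterate_add_apply, hm, x.iterate_root] at h1
  exact h1.symm

/-- A subtree is determined by its set of vertices. -/
theorem ext_carrier {s s' : x.Subtree} (h : s.carrier = s'.carrier) : s = s' := by
  have htop : s.top = s'.top := by
    obtain ⟨k, hk, -⟩ := s.exists_path s'.top (h ▸ s'.top_mem)
    obtain ⟨l, hl, -⟩ := s'.exists_path s.top (h ▸ s.top_mem)
    rcases k with _ | k
    · exact hk.symm
    · have h1 : s'.top = x.root := by
        refine eq_root_of_cycle x (k := l + k) ?_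
        rw [show l + k + 1 = l + (k + 1) by ring, Function.iterate_add_apply, hk, hl]
      rw [← hk, h1, x.iterate_root]
  cases s; cases s'; simp_all

open Classical in
/-- A subtree as a rooted tree of its own, rooted at its top vertex. -/
noncomputable def toTree (s : x.Subtree) : RootedTreeOn s.carrier where
  root := ⟨s.top, s.top_mem⟩
  parent v := if h : v.1 = s.top then v else ⟨x.parent v.1, s.parent_mem v.2 h⟩
  parent_root := by simp
  exists_iterate := by
    rintro ⟨v, hv⟩
    obtain ⟨k, hk, -⟩ := s.exists_path v hv
    induction k generalizing v with
    | zero => exact ⟨0, Subtype.ext hk⟩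
    | succ k ih =>
      by_cases h : v = s.top
      · exact ⟨0, Subtype.ext h⟩
      · obtain ⟨j, hj⟩ := ih (x.parent v) (s.parent_mem hv h) hk
        refine ⟨j + 1, ?_⟩
        rw [Function.iterate_succ_apply]
        simpa [h] using hj

open Classical in
/-- The map from the vertices of `x` to those of the contracted tree: all the vertices of the
subtree `s` are sent to a single one, represented by the top of `s`. -/
noncomputable def collapse (s : x.Subtree) (v : V) : {v : V // v ∈ s.carrier → v = s.top} :=
  if h : v ∈ s.carrier then ⟨s.top, fun _ => rfl⟩ else ⟨v, fun h' => absurd h' h⟩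

theorem collapse_of_mem (s : x.Subtree) {v : V} (h : v ∈ s.carrier) :
    s.collapse v = ⟨s.top, fun _ => rfl⟩ := dif_pos h

theorem collapse_coe (s : x.Subtree) (v : {v : V // v ∈ s.carrier → v = s.top}) :
    s.collapse v.1 = v := by
  by_cases h : v.1 ∈ s.carrier
  · rw [s.collapse_of_mem h]; exact Subtype.ext (v.2 h).symm
  · exact dif_neg h

/-- The contracted tree `x / s`, obtained by shrinking the subtree `s` to a single vertex. Its
vertices are those of `x` outside `s` and one more vertex, represented by the top of `s`. -/
noncomputable def contract (s : x.Subtree) :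
    RootedTreeOn {v : V // v ∈ s.carrier → v = s.top} where
  root := s.collapse x.root
  parent v := s.collapse (x.parent v.1)
  parent_root := by
    by_cases h : x.root ∈ s.carrier
    · rw [s.collapse_of_mem h]
      simp only [s.top_eq_root h, x.parent_root]
      rw [s.collapse_of_mem h]
      exact Subtype.ext (s.top_eq_root h)
    · have : (s.collapse x.root).1 = x.root := by simp [collapse, h]
      rw [this, x.parent_root]
  exists_iterate := by
    intro v
    obtain ⟨k, hk⟩ := x.exists_iterate v.1
    obtain ⟨w, hw⟩ : ∃ w, w = v.1 := ⟨_, rfl⟩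
    rw [← s.collapse_coe v, ← hw]
    rw [← hw] at hk
    clear hw v
    induction k generalizing w with
    | zero => exact ⟨0, congrArg s.collapse hk⟩
    | succ k ih =>
      obtain ⟨j, hj⟩ := ih (x.parent w) hk
      by_cases h : w ∈ s.carrier ∧ w ≠ s.top
      · refine ⟨j, ?_⟩
        rwa [s.collapse_of_mem h.1, ← s.collapse_of_mem (s.parent_mem h.1 h.2)]
      · refine ⟨j + 1, ?_⟩
        have hw : (s.collapse w).1 = w := by
          by_cases h' : w ∈ s.carrier
          · rw [s.collapse_of_mem h']
            by_contra h''
            exact h ⟨h', fun e => h'' e.symm⟩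
          · simp [collapse, h']
        rw [Function.iterate_succ_apply]
        simpa only [hw] using hj

theorem card_contract [Finite V] (s : x.Subtree) :
    Nat.card {v : V // v ∈ s.carrier → v = s.top} + Nat.card s.carrier = Nat.card V + 1 := by
  have h1 : {v : V | v ∈ s.carrier → v = s.top} = insert s.top s.carrierᶜ := by
    ext v
    simp only [Set.mem_ofPred_eq, Set.mem_insert_iff, Set.mem_compl_iff]
    tauto
  have h2 : Nat.card {v : V // v ∈ s.carrier → v = s.top}
      = (insert s.top s.carrierᶜ : Set V).ncard := by
    rw [← h1]; rfl
  rw [h2, Set.ncard_insert_of_notMem (by simpa using s.top_mem) (Set.toFinite _)]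
  have h3 := Set.ncard_add_ncard_compl s.carrier
  have h4 : Nat.card s.carrier = s.carrier.ncard := rfl
  omega

end Subtree

/-- The elementary cut of `x` at the edge from `w` to its parent: `branch` is the part that is
cut off (the vertices whose path to the root passes through `w`), with root `w`. -/
def branch (x : RootedTreeOn V) (w : V) : x.Subtree where
  carrier := {v | ∃ k, x.parent^[k] v = w}
  top := w
  top_mem := ⟨0, rfl⟩
  exists_path := by
    rintro v ⟨k, hk⟩
    refine ⟨k, hk, fun j hj => ⟨k - j, ?_⟩⟩
    rw [← Function.iterate_add_apply, Nat.sub_add_cancel hj, hk]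

/-- The elementary cut of `x` at the edge from `w` to its parent: `trunk` is the part that
contains the root. -/
def trunk (x : RootedTreeOn V) (w : V) (hw : w ≠ x.root) : x.Subtree where
  carrier := {v | ¬ ∃ k, x.parent^[k] v = w}
  top := x.root
  top_mem := by
    rintro ⟨k, hk⟩
    exact hw (by rw [← hk, x.iterate_root])
  exists_path := by
    intro v hv
    obtain ⟨k, hk⟩ := x.exists_iterate v
    refine ⟨k, hk, fun j _ => ?_⟩
    rintro ⟨i, hi⟩
    exact hv ⟨i + j, by rw [Function.iterate_add_apply, hi]⟩

/-- The number of elementary cuts of `x` with branch isomorphic to `t` and trunk isomorphic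
to `u`. -/
noncomputable def cutCount {T U : Type} (t : RootedTreeOn T) (u : RootedTreeOn U)
    (x : RootedTreeOn V) : ℕ :=
  Nat.card {w : {w : V // w ≠ x.root} //
    (x.branch w.1).toTree.Iso t ∧ (x.trunk w.1 w.2).toTree.Iso u}

/-- The number of subtrees `s` of `x` isomorphic to `t` such that the contracted tree `x / s` is
isomorphic to `u`. -/
noncomputable def subtreeCount {T U : Type} (t : RootedTreeOn T) (u : RootedTreeOn U)
    (x : RootedTreeOn V) : ℕ :=
  Nat.card {s : x.Subtree // s.toTree.Iso t ∧ s.contract.Iso u}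

theorem card_of_cutCount_ne_zero [Finite V] {T U : Type} {t : RootedTreeOn T}
    {u : RootedTreeOn U} {x : RootedTreeOn V} (h : cutCount t u x ≠ 0) :
    Nat.card V = Nat.card T + Nat.card U := by
  obtain ⟨⟨w, ht, hu⟩⟩ := (Nat.card_ne_zero.1 h).1
  rw [← ht.card_eq, ← hu.card_eq]
  exact (Set.ncard_add_ncard_compl (x.branch w.1).carrier).symm

theorem card_of_subtreeCount_ne_zero [Finite V] {T U : Type} {t : RootedTreeOn T}
    {u : RootedTreeOn U} {x : RootedTreeOn V} (h : subtreeCount t u x ≠ 0) :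
    Nat.card V + 1 = Nat.card T + Nat.card U := by
  obtain ⟨⟨s, ht, hu⟩⟩ := (Nat.card_ne_zero.1 h).1
  rw [← ht.card_eq, ← hu.card_eq, ← s.card_contract, add_comm]

instance (n : ℕ) : Finite (RootedTreeOn (Fin n)) := by
  refine Finite.of_injective (fun x => (x.root, x.parent)) ?_
  rintro ⟨r, p, _, _⟩ ⟨r', p', _, _⟩ h
  simp only [Prod.mk.injEq] at h
  obtain ⟨rfl, rfl⟩ := h
  rfl

instance isoSetoid (n : ℕ) : Setoid (RootedTreeOn (Fin n)) where
  r x y := x.Iso y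
  iseqv := ⟨Iso.refl, Iso.symm, Iso.trans⟩

end RootedTreeOn

/-- Finite rooted trees up to isomorphism: a number `n` of vertices and an isomorphism class of
rooted trees with `n` vertices. (There is none with `n = 0`.) -/
def IsoTree : Type := Σ n : ℕ, Quotient (RootedTreeOn.isoSetoid n)

namespace IsoTree

/-- The number of vertices. -/
def size (t : IsoTree) : ℕ := t.1

/-- A rooted tree in the isomorphism class `t`. -/
noncomputable def rep (t : IsoTree) : RootedTreeOn (Fin t.size) := Quotient.out t.2

theorem finite_size_eq (n : ℕ) : {t : IsoTree | t.size = n}.Finite := by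
  refine (Set.finite_range (fun q : Quotient (RootedTreeOn.isoSetoid n) =>
    (⟨n, q⟩ : IsoTree))).subset ?_
  rintro ⟨m, q⟩ (rfl : m = n)
  exact ⟨q, rfl⟩

/-- `N(t, u, x)`: the number of elementary cuts of `x` with branch `t` and trunk `u`. -/
noncomputable def cutNumber (t u x : IsoTree) : ℕ :=
  RootedTreeOn.cutCount t.rep u.rep x.rep

/-- `𝒩(t, u, x)`: the number of subtrees of `x` isomorphic to `t` whose contraction gives `u`. -/
noncomputable def subtreeNumber (t u x : IsoTree) : ℕ :=
  RootedTreeOn.subtreeCount t.rep u.rep x.rep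

variable (K : Type*) [Field K]

theorem finite_support_cutNumber (t u : IsoTree) :
    (Function.support fun x => (cutNumber t u x : K)).Finite := by
  refine (finite_size_eq (t.size + u.size)).subset fun x hx => ?_
  have h : cutNumber t u x ≠ 0 := fun h => hx (by simp [h])
  simpa using RootedTreeOn.card_of_cutCount_ne_zero h

theorem finite_support_subtreeNumber (t u : IsoTree) :
    (Function.support fun x => (subtreeNumber t u x : K)).Finite := by
  refine (finite_size_eq (t.size + u.size - 1)).subset fun x hx => ?_
  have h : subtreeNumber t u x ≠ 0 := fun h => hx (by simp [h])
  have h' := RootedTreeOn.card_of_subtreeCount_ne_zero h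
  simp only [Nat.card_eq_fintype_card, Fintype.card_fin] at h'
  simp only [Set.mem_ofPred_eq]
  omega

/-- `t → u = ∑ N(t, u, x) x`, the sum being over all rooted trees `x`. -/
noncomputable def graft (t u : IsoTree) : IsoTree →₀ K :=
  Finsupp.ofSupportFinite _ (finite_support_cutNumber K t u)

/-- `t ▷ u = ∑ 𝒩(t, u, x) x`, the sum being over all rooted trees `x`. -/
noncomputable def insertTree (t u : IsoTree) : IsoTree →₀ K :=
  Finsupp.ofSupportFinite _ (finite_support_subtreeNumber K t u)

end IsoTree

/-- The vector space `𝒯` with basis the rooted trees. -/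
abbrev TreeSpace (K : Type*) [Field K] : Type _ := IsoTree →₀ K

/-- The vector space `𝒯'` with basis the rooted trees with at least one edge, i.e. with at least
two vertices. -/
abbrev EdgeTreeSpace (K : Type*) [Field K] : Type _ := {t : IsoTree // 2 ≤ t.size} →₀ K

/-- The grafting law `u → v` on `𝒯`, extended bilinearly from trees. -/
noncomputable def grafting (K : Type*) [Field K] :
    TreeSpace K →ₗ[K] TreeSpace K →ₗ[K] TreeSpace K :=
  Finsupp.linearCombination K fun t => Finsupp.linearCombination K fun u => IsoTree.graft K t u

/-- The insertion law `t ▷ u` for `t` in `𝒯'` and `u` in `𝒯`, extended bilinearly from trees. -/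
noncomputable def insertion (K : Type*) [Field K] :
    EdgeTreeSpace K →ₗ[K] TreeSpace K →ₗ[K] TreeSpace K :=
  Finsupp.linearCombination K fun t =>
    Finsupp.linearCombination K fun u => IsoTree.insertTree K t.1 u

/-! Both sides are compared coefficient by coefficient at a fixed tree `x`, and both become sums
over pairs of a subtree `s` and an edge of `x`. On the left, one contracts `s` and then cuts an edge
of `x / s`; these edges are the edges of `x` not in `s`. On the right, one cuts an edge of `x` first
and then contracts a subtree of the branch or of the trunk.

For an edge outside `s`, connectedness puts `s` entirely in the branch or entirely in the trunk.
Cutting then commutes with contracting: the part containing `s` is contracted and the other part is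
unchanged (`restrict_contract_iso`, `disjoint_contract_iso`). For an edge of `s`, neither part
contains `s`, so the pair contributes to neither side. This trichotomy is `sum_edge_contract`, and
`sum_subtree` rewrites the right side over the same pairs.

The formulas `grafting_apply_isoClass` and `insertion_apply_isoClass` reduce the theorem to these
sums; there `mapDomain Subtype.val` extends `t` by zero to all trees. -/

namespace RootedTreeOn

variable {V W : Type}

/-! ### Isomorphism criterion and the ancestor order -/

/-- Two rooted trees whose vertices are embedded in a common type are isomorphic as soon as the
embeddings have the same range and agree on roots and on parents. -/
theorem Iso.of_injective {X : Type} {x : RootedTreeOn V} {y : RootedTreeOn W} (f : V → X)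
    (g : W → X) (hf : f.Injective) (hg : g.Injective) (hr : Set.range f = Set.range g)
    (hroot : f x.root = g y.root)
    (hp : ∀ v w, f v = g w → v ≠ x.root → f (x.parent v) = g (y.parent w)) : x.Iso y := by
  let e : V ≃ W :=
    (Equiv.ofInjective f hf).trans ((Equiv.setCongr hr).trans (Equiv.ofInjective g hg).symm)
  have he : ∀ v, g (e v) = f v := fun v => by
    simp only [e, Equiv.trans_apply, Equiv.apply_ofInjective_symm hg]
    rfl
  have h0 : e x.root = y.root := hg (by rw [he, hroot])
  refine ⟨e, h0, fun v => ?_⟩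
  -- The parent of the root is a mere convention, shared by both trees, so `hp` is needed only away
  -- from the root.
  by_cases hv : v = x.root
  · rw [hv, x.parent_root, h0, y.parent_root]
  · exact hg (by rw [he, hp v (e v) (he v).symm hv])

/-- Antisymmetry of the ancestor order: a nontrivial closed path upwards can only sit at the root,
where `parent` is stationary. -/
theorem eq_of_reach_reach (x : RootedTreeOn V) {v w : V} (h : ∃ k, x.parent^[k] v = w)
    (h' : ∃ k, x.parent^[k] w = v) : v = w := by
  obtain ⟨k, hk⟩ := h
  obtain ⟨l, hl⟩ := h'
  rcases k with _ | k
  · exact hk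
  · have h1 : v = x.root := by
      refine Subtree.eq_root_of_cycle x (k := l + k) ?_
      rw [show l + k + 1 = l + (k + 1) by ring, Function.iterate_add_apply, hk, hl]
    rw [← hk, h1, x.iterate_root]

theorem reach_trans (x : RootedTreeOn V) {u v w : V} (h : ∃ k, x.parent^[k] u = v)
    (h' : ∃ k, x.parent^[k] v = w) : ∃ k, x.parent^[k] u = w := by
  obtain ⟨k, hk⟩ := h
  obtain ⟨l, hl⟩ := h'
  exact ⟨l + k, by rw [Function.iterate_add_apply, hk, hl]⟩

/-! ### Subtrees of a subtree, and their contraction -/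

namespace Subtree

variable {x : RootedTreeOn V} {y : RootedTreeOn W}

theorem reach_top (s : x.Subtree) {v : V} (hv : v ∈ s.carrier) : ∃ k, x.parent^[k] v = s.top :=
  let ⟨k, hk, _⟩ := s.exists_path v hv
  ⟨k, hk⟩

/-- A set of vertices closed under taking parents except at one of its vertices is a subtree. -/
def ofParentMem (x : RootedTreeOn V) (c : Set V) (top : V) (top_mem : top ∈ c)
    (hp : ∀ v ∈ c, v ≠ top → x.parent v ∈ c) (hroot : x.root ∈ c → top = x.root) :
    x.Subtree where
  carrier := c
  top := top
  top_mem := top_mem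
  exists_path := by
    intro v hv
    obtain ⟨n, hn⟩ := x.exists_iterate v
    induction n generalizing v with
    | zero =>
      -- The path from the root never moves, so it reaches `top` only if they coincide; `hroot`
      -- supplies this.
      obtain rfl : v = x.root := hn
      exact ⟨0, (hroot hv).symm, fun j hj => by obtain rfl : j = 0 := by omega
                                                exact hv⟩
    | succ n ih =>
      by_cases h : v = top
      · exact ⟨0, h, fun j hj => by obtain rfl : j = 0 := by omega
                                    exact hv⟩
      · obtain ⟨k, hk, hj⟩ := ih (x.parent v) (hp v hv h) hn
        refine ⟨k + 1, hk, fun j hjk => ?_⟩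
        rcases j with _ | j
        · exact hv
        · exact hj j (by omega)

/-- Each top is an ancestor of the other, so antisymmetry applies. -/
theorem top_eq_of_subset {s b : x.Subtree} (h : s.carrier ⊆ b.carrier)
    (hb : b.top ∈ s.carrier) : s.top = b.top :=
  x.eq_of_reach_reach (b.reach_top (h s.top_mem)) (s.reach_top hb)

theorem coe_toTree_parent (s : x.Subtree) {v : s.carrier} (h : v.1 ≠ s.top) :
    (s.toTree.parent v).1 = x.parent v.1 := by
  simp [toTree, h]

open Classical in
theorem coe_collapse (s : x.Subtree) (v : V) :
    (s.collapse v).1 = if v ∈ s.carrier then s.top else v := by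
  unfold collapse
  split_ifs <;> rfl

/-- A subtree of `x` contained in the subtree `b`, as a subtree of `b`. -/
noncomputable def restrict (b s : x.Subtree) (h : s.carrier ⊆ b.carrier) : b.toTree.Subtree :=
  ofParentMem b.toTree (Subtype.val ⁻¹' s.carrier) ⟨s.top, h s.top_mem⟩ s.top_mem
    (by
      rintro v hv hne
      by_cases hb : v.1 = b.top
      · exact absurd (Subtype.ext (hb.trans (top_eq_of_subset h (hb ▸ hv)).symm)) hne
      · rw [Set.mem_preimage, b.coe_toTree_parent hb]
        exact s.parent_mem hv fun h' => hne (Subtype.ext h'))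
    (fun hb => Subtype.ext (top_eq_of_subset h hb))

/-- A subtree of the subtree `b` of `x`, as a subtree of `x`. -/
noncomputable def extend (b : x.Subtree) (s : b.toTree.Subtree) : x.Subtree :=
  ofParentMem x (Subtype.val '' s.carrier) s.top.1 ⟨_, s.top_mem, rfl⟩
    (by
      rintro _ ⟨v, hv, rfl⟩ hne
      have hv' : v ≠ s.top := fun h' => hne (congrArg _ h')
      refine ⟨_, s.parent_mem hv hv', b.coe_toTree_parent fun hb => ?_⟩
      have h1 : v = b.toTree.root := Subtype.ext hb
      exact hv' (h1.trans (s.top_eq_root (h1 ▸ hv)).symm))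
    (by
      rintro ⟨v, hv, hr⟩
      have h1 : v = b.toTree.root := Subtype.ext (hr.trans (b.top_eq_root (hr ▸ v.2)).symm)
      rw [s.top_eq_root (h1 ▸ hv), ← h1, hr])

/-- Subtrees of a subtree `b` of `x` correspond to the subtrees of `x` contained in `b`. -/
noncomputable def restrictEquiv (b : x.Subtree) :
    {s : x.Subtree // s.carrier ⊆ b.carrier} ≃ b.toTree.Subtree where
  toFun s := b.restrict s.1 s.2
  invFun s := ⟨b.extend s, by rintro _ ⟨v, -, rfl⟩; exact v.2⟩
  left_inv s := Subtype.ext (ext_carrier (Subtype.coe_image_of_subset s.2))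
  right_inv s := ext_carrier (Set.preimage_image_eq _ Subtype.val_injective)

theorem restrict_toTree_iso (b s : x.Subtree) (h : s.carrier ⊆ b.carrier) :
    (b.restrict s h).toTree.Iso s.toTree := by
  refine Iso.of_injective (fun v => v.1.1) Subtype.val
    (Subtype.val_injective.comp Subtype.val_injective) Subtype.val_injective ?_ rfl ?_
  · ext v
    simp only [Set.mem_range, Subtype.exists, exists_prop, exists_eq_right]
    exact ⟨by rintro ⟨_, _, hs, rfl⟩; exact hs, fun hs => ⟨v, h hs, hs, rfl⟩⟩
  · rintro v w hvw hne
    have h1 : v.1 ≠ (b.restrict s h).top := fun h' => hne (Subtype.ext h')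
    have h2 : v.1.1 ≠ s.top := fun h' => h1 (Subtype.ext h')
    have h3 : v.1.1 ≠ b.top := fun h' =>
      h2 (h'.trans (top_eq_of_subset h (h' ▸ v.2)).symm)
    rw [coe_toTree_parent _ h1, coe_toTree_parent _ h3, coe_toTree_parent _ (hvw ▸ h2), hvw]

/-- If `s ⊆ b`, then the contraction of `s` in `b` is the subtree of `x / s` formed by the
vertices of `b`. -/
theorem restrict_contract_iso (b s : x.Subtree) (h : s.carrier ⊆ b.carrier)
    (c : s.contract.Subtree) (hc : ∀ v, v ∈ c.carrier ↔ v.1 ∈ b.carrier)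
    (htop : c.top = s.collapse b.top) : c.toTree.Iso (b.restrict s h).contract := by
  classical
  refine Iso.of_injective (fun v => v.1.1) (fun v => v.1.1)
    (Subtype.val_injective.comp Subtype.val_injective)
    (Subtype.val_injective.comp Subtype.val_injective) ?_ ?_ ?_
  · ext v
    simp only [Set.mem_range]
    constructor
    · rintro ⟨w, rfl⟩
      exact ⟨⟨⟨w.1.1, (hc _).1 w.2⟩, fun h' => Subtype.ext (w.1.2 h')⟩, rfl⟩
    · rintro ⟨w, rfl⟩
      exact ⟨⟨⟨w.1.1, fun h' => congrArg Subtype.val (w.2 h')⟩, (hc _).2 w.1.2⟩, rfl⟩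
  · change c.top.1 = ((b.restrict s h).collapse b.toTree.root).1.1
    rw [htop, coe_collapse, coe_collapse]
    -- Membership in the restricted subtree unfolds to membership in `s`, so both collapses branch
    -- on the same condition.
    change _ = Subtype.val (if b.top ∈ s.carrier then _ else _)
    split_ifs <;> rfl
  · intro v w hvw hne
    have h1 : v.1 ≠ c.top := fun h' => hne (Subtype.ext h')
    have h2 : w.1.1 ≠ b.top := by
      intro h'
      have h4 : v.1.1 = w.1.1 := hvw
      refine h1 ?_
      rw [htop, ← h', ← h4, s.collapse_coe]
    rw [coe_toTree_parent _ h1]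
    change (s.collapse (x.parent v.1.1)).1 =
      ((b.restrict s h).collapse (b.toTree.parent w.1)).1.1
    rw [coe_collapse, coe_collapse]
    change _ = Subtype.val (if (b.toTree.parent w.1).1 ∈ s.carrier then _ else _)
    have h3 := b.coe_toTree_parent h2
    rw [h3]
    have h4 : v.1.1 = w.1.1 := hvw
    rw [h4]
    split_ifs
    · rfl
    · exact h3.symm

/-- If `s` is disjoint from `b`, then `b` is isomorphic to the subtree of `x / s` formed by the
vertices of `b`. -/
theorem disjoint_contract_iso (b s : x.Subtree) (h : Disjoint s.carrier b.carrier)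
    (c : s.contract.Subtree) (hc : ∀ v, v ∈ c.carrier ↔ v.1 ∈ b.carrier)
    (htop : c.top = s.collapse b.top) : c.toTree.Iso b.toTree := by
  classical
  have hs : ∀ v ∈ b.carrier, (s.collapse v).1 = v := fun v hv => by
    rw [coe_collapse, if_neg (Set.disjoint_right.1 h hv)]
  refine Iso.of_injective (fun v => v.1.1) Subtype.val
    (Subtype.val_injective.comp Subtype.val_injective) Subtype.val_injective ?_ ?_ ?_
  · ext v
    simp only [Set.mem_range]
    constructor
    · rintro ⟨w, rfl⟩
      exact ⟨⟨w.1.1, (hc _).1 w.2⟩, rfl⟩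
    · rintro ⟨w, rfl⟩
      exact ⟨⟨⟨w.1, fun h' => absurd w.2 (Set.disjoint_left.1 h h')⟩, (hc _).2 w.2⟩, rfl⟩
  · change c.top.1 = b.top
    rw [htop, hs _ b.top_mem]
  · intro v w hvw hne
    have h1 : v.1 ≠ c.top := fun h' => hne (Subtype.ext h')
    have h4 : v.1.1 = w.1 := hvw
    have h2 : w.1 ≠ b.top := by
      intro h'
      refine h1 (Subtype.ext ?_)
      rw [htop, h4, h', hs _ b.top_mem]
    rw [coe_toTree_parent _ h1, coe_toTree_parent _ h2]
    change (s.collapse (x.parent v.1.1)).1 = _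
    rw [h4, hs _ (b.parent_mem w.2 h2)]

/-! ### Transport of subtrees along an isomorphism -/

/-- The image of a subtree under an isomorphism. -/
def map (e : V ≃ W) (h0 : e x.root = y.root) (he : ∀ v, e (x.parent v) = y.parent (e v))
    (s : x.Subtree) : y.Subtree :=
  ofParentMem y (e '' s.carrier) (e s.top) ⟨_, s.top_mem, rfl⟩
    (by
      rintro _ ⟨v, hv, rfl⟩ hne
      exact ⟨_, s.parent_mem hv fun h => hne (congrArg e h), he v⟩)
    (by
      rintro ⟨v, hv, hr⟩
      obtain rfl : v = x.root := e.injective (hr.trans h0.symm)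
      rw [s.top_eq_root hv, h0])

section map

variable (e : V ≃ W) (h0 : e x.root = y.root) (he : ∀ v, e (x.parent v) = y.parent (e v))

theorem map_injective : (map e h0 he).Injective := fun _ _ h =>
  ext_carrier (e.injective.image_injective (congrArg carrier h))

theorem iso_map_toTree (s : x.Subtree) : s.toTree.Iso (s.map e h0 he).toTree := by
  refine Iso.of_injective (fun v => e v.1) Subtype.val
    (e.injective.comp Subtype.val_injective) Subtype.val_injective ?_ rfl ?_
  · ext v
    simp only [Set.mem_range, Subtype.exists, exists_prop, exists_eq_right]
    exact Iff.rfl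
  · intro v w hvw hne
    have h1 : v.1 ≠ s.top := fun h' => hne (Subtype.ext h')
    have h2 : w.1 ≠ (s.map e h0 he).top := by
      rw [← hvw]
      exact fun h' => h1 (e.injective h')
    rw [coe_toTree_parent _ h1, coe_toTree_parent _ h2, he, hvw]

theorem coe_collapse_map (s : x.Subtree) (v : V) :
    ((s.map e h0 he).collapse (e v)).1 = e (s.collapse v).1 := by
  classical
  rw [coe_collapse, coe_collapse]
  have : e v ∈ (s.map e h0 he).carrier ↔ v ∈ s.carrier := e.injective.mem_set_image
  simp only [this]
  split_ifs <;> rfl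

theorem iso_map_contract (s : x.Subtree) : s.contract.Iso (s.map e h0 he).contract := by
  have hmem (v : V) : e v ∈ (s.map e h0 he).carrier ↔ v ∈ s.carrier :=
    e.injective.mem_set_image
  refine Iso.of_injective (fun v => e v.1) Subtype.val
    (e.injective.comp Subtype.val_injective) Subtype.val_injective ?_ ?_ ?_
  · ext w
    obtain ⟨v, rfl⟩ := e.surjective w
    simp only [Set.mem_range, Subtype.exists, exists_prop, exists_eq_right]
    rw [hmem]
    constructor
    · rintro ⟨v', h, hv⟩ hs
      obtain rfl := e.injective hv
      exact congrArg e (h hs)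
    · exact fun h => ⟨v, fun hs => e.injective (h hs), rfl⟩
  · change e (s.collapse x.root).1 = ((s.map e h0 he).collapse y.root).1
    rw [← h0, coe_collapse_map]
  · intro v w hvw _
    change e (s.collapse (x.parent v.1)).1 = ((s.map e h0 he).collapse (y.parent w.1)).1
    rw [← hvw, ← he, coe_collapse_map]

end map

/-! ### Ancestor order and edges of the contracted tree -/

/-- A vertex of `x / s` lies below another one if and only if it does so in `x`. -/
theorem contract_reach_iff (s : x.Subtree) (v w : {v : V // v ∈ s.carrier → v = s.top}) :
    (∃ k, s.contract.parent^[k] v = w) ↔ ∃ k, x.parent^[k] v.1 = w.1 := by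
  classical
  constructor
  · rintro ⟨k, hk⟩
    induction k generalizing v with
    | zero => exact ⟨0, congrArg Subtype.val hk⟩
    | succ k ih =>
      have h1 := ih (s.contract.parent v) hk
      -- One step in `x / s` is one step in `x`, followed by a climb to the top of `s` if that step
      -- lands in `s`.
      refine x.reach_trans ⟨1, rfl⟩ (x.reach_trans ?_ h1)
      change ∃ k, x.parent^[k] (x.parent v.1) = (s.collapse (x.parent v.1)).1
      rw [coe_collapse]
      split_ifs with h
      · exact s.reach_top h
      · exact ⟨0, rfl⟩
  · rintro ⟨k, hk⟩
    -- The path in `x` may run through vertices of `s` that are absent from `x / s`, so the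
    -- induction covers every vertex `u` via its image.
    suffices ∀ u, x.parent^[k] u = w.1 → ∃ k, s.contract.parent^[k] (s.collapse u) = w by
      simpa only [s.collapse_coe] using this v.1 hk
    clear hk
    induction k with
    | zero => exact fun u hu => ⟨0, (congrArg s.collapse hu).trans (s.collapse_coe w)⟩
    | succ k ih =>
      intro u hu
      have h1 := ih (x.parent u) hu
      -- If `u` is in `s` below its top, `u` and its parent have the same image and the step
      -- disappears; otherwise `u` is its own image and the step survives.
      by_cases h : u ∈ s.carrier ∧ u ≠ s.top
      · rwa [s.collapse_of_mem h.1, ← s.collapse_of_mem (s.parent_mem h.1 h.2)]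
      · refine s.contract.reach_trans ⟨1, ?_⟩ h1
        have hu' : (s.collapse u).1 = u := by
          rw [coe_collapse]
          split_ifs with h'
          · by_contra h''
            exact h ⟨h', fun e => h'' e.symm⟩
          · rfl
        change s.collapse (x.parent (s.collapse u).1) = _
        rw [hu']

theorem ne_contract_root_iff (s : x.Subtree) (w : {v : V // v ∈ s.carrier → v = s.top}) :
    w ≠ s.contract.root ↔ w.1 ≠ x.root := by
  classical
  have : s.contract.root.1 = x.root := by
    change (s.collapse x.root).1 = _
    rw [coe_collapse]
    split_ifs with h
    · exact s.top_eq_root h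
    · rfl
  rw [Ne, Subtype.ext_iff, this]

instance [Finite V] : Finite x.Subtree :=
  Finite.of_injective carrier fun _ _ => ext_carrier

noncomputable instance [Finite V] : Fintype x.Subtree := Fintype.ofFinite _

end Subtree

/-- The edges of a rooted tree, each represented by its lower end. -/
abbrev Edge (x : RootedTreeOn V) : Type := {w : V // w ≠ x.root}

noncomputable instance [Finite V] (x : RootedTreeOn V) : Fintype x.Edge := Fintype.ofFinite _

/-! ### Isomorphism invariance of the two counts -/

section invariance

variable {x : RootedTreeOn V} {y : RootedTreeOn W}

theorem map_branch (e : V ≃ W) (h0 : e x.root = y.root)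
    (he : ∀ v, e (x.parent v) = y.parent (e v)) (w : V) :
    (x.branch w).map e h0 he = y.branch (e w) := by
  refine Subtree.ext_carrier (Set.ext fun u => ?_)
  obtain ⟨v, rfl⟩ := e.surjective u
  refine e.injective.mem_set_image.trans (exists_congr fun k => ?_)
  rw [← (Function.Semiconj.iterate_right he k).eq, e.injective.eq_iff]

theorem map_trunk (e : V ≃ W) (h0 : e x.root = y.root)
    (he : ∀ v, e (x.parent v) = y.parent (e v)) (w : V) (hw : w ≠ x.root)
    (hw' : e w ≠ y.root) :
    (x.trunk w hw).map e h0 he = y.trunk (e w) hw' := by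
  refine Subtree.ext_carrier (Set.ext fun u => ?_)
  obtain ⟨v, rfl⟩ := e.surjective u
  refine e.injective.mem_set_image.trans (not_congr (exists_congr fun k => ?_))
  rw [← (Function.Semiconj.iterate_right he k).eq, e.injective.eq_iff]

/-- The isomorphism sends cuts injectively to cuts of the same type. An inequality is enough, since
the inverse isomorphism gives the other one. -/
theorem Iso.cutCount_le [Finite W] {T U : Type} {t : RootedTreeOn T} {u : RootedTreeOn U}
    (h : x.Iso y) : cutCount t u x ≤ cutCount t u y := by
  obtain ⟨e, h0, he⟩ := h
  have hne {w : V} (hw : w ≠ x.root) : e w ≠ y.root := fun h => hw (e.injective (h.trans h0.symm))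
  refine Nat.card_le_card_of_injective
    (fun w => ⟨⟨e w.1.1, hne w.1.2⟩, ?_, ?_⟩) ?_
  · rw [← map_branch e h0 he]
    exact (Subtree.iso_map_toTree e h0 he _).symm.trans w.2.1
  · rw [← map_trunk e h0 he _ w.1.2]
    exact (Subtree.iso_map_toTree e h0 he _).symm.trans w.2.2
  · intro w w' h
    simp only [Subtype.mk.injEq, e.injective.eq_iff] at h
    exact Subtype.ext (Subtype.ext h)

theorem Iso.subtreeCount_le [Finite W] {T U : Type} {t : RootedTreeOn T} {u : RootedTreeOn U}
    (h : x.Iso y) : subtreeCount t u x ≤ subtreeCount t u y := by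
  obtain ⟨e, h0, he⟩ := h
  refine Nat.card_le_card_of_injective
    (fun s => ⟨s.1.map e h0 he, (Subtree.iso_map_toTree e h0 he _).symm.trans s.2.1,
      (Subtree.iso_map_contract e h0 he _).symm.trans s.2.2⟩) ?_
  intro s s' h
  exact Subtype.ext (Subtree.map_injective e h0 he (congrArg Subtype.val h))

theorem Iso.cutCount_eq [Finite V] [Finite W] {T U : Type} {t : RootedTreeOn T}
    {u : RootedTreeOn U} (h : x.Iso y) : cutCount t u x = cutCount t u y :=
  h.cutCount_le.antisymm h.symm.cutCount_le

theorem Iso.subtreeCount_eq [Finite V] [Finite W] {T U : Type} {t : RootedTreeOn T}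
    {u : RootedTreeOn U} (h : x.Iso y) : subtreeCount t u x = subtreeCount t u y :=
  h.subtreeCount_le.antisymm h.symm.subtreeCount_le

end invariance

/-! ### Isomorphism classes of finite rooted trees -/

/-- Transport of a rooted tree along a bijection of the vertices. -/
def transport (x : RootedTreeOn V) (e : V ≃ W) : RootedTreeOn W where
  root := e x.root
  parent w := e (x.parent (e.symm w))
  parent_root := by simp [x.parent_root]
  exists_iterate w := by
    obtain ⟨k, hk⟩ := x.exists_iterate (e.symm w)
    have h : Function.Semiconj e x.parent fun w => e (x.parent (e.symm w)) := fun v => by simp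
    exact ⟨k, by rw [← hk, (h.iterate_right k).eq, e.apply_symm_apply]⟩

theorem iso_transport (x : RootedTreeOn V) (e : V ≃ W) : x.Iso (x.transport e) :=
  ⟨e, rfl, fun v => by simp [transport]⟩

/-- The isomorphism class of a finite rooted tree. -/
noncomputable def isoClass [Finite V] (x : RootedTreeOn V) : IsoTree :=
  ⟨Nat.card V, Quotient.mk _ (x.transport (Finite.equivFin V))⟩

theorem iso_rep_isoClass [Finite V] (x : RootedTreeOn V) : x.Iso x.isoClass.rep :=
  (x.iso_transport _).trans
    (Iso.symm (Quotient.mk_out (s := isoSetoid (Nat.card V)) (x.transport (Finite.equivFin V))))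

end RootedTreeOn

namespace IsoTree

open RootedTreeOn

theorem eq_of_rep_iso {t u : IsoTree} (h : t.rep.Iso u.rep) : t = u := by
  have hs : t.size = u.size := by simpa using h.card_eq
  obtain ⟨n, q⟩ := t
  obtain ⟨m, r⟩ := u
  obtain rfl : n = m := hs
  exact congrArg _ (Quotient.out_equiv_out.1 h)

theorem isoClass_eq_iff {V : Type} [Finite V] {x : RootedTreeOn V} {t : IsoTree} :
    x.isoClass = t ↔ x.Iso t.rep :=
  ⟨fun h => h ▸ x.iso_rep_isoClass,
    fun h => eq_of_rep_iso (x.iso_rep_isoClass.symm.trans h)⟩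

theorem isoClass_rep (t : IsoTree) : t.rep.isoClass = t :=
  isoClass_eq_iff.2 (Iso.refl _)

end IsoTree

theorem RootedTreeOn.Iso.isoClass_eq {V W : Type} [Finite V] [Finite W] {x : RootedTreeOn V}
    {y : RootedTreeOn W} (h : x.Iso y) : x.isoClass = y.isoClass :=
  IsoTree.isoClass_eq_iff.2 (h.trans y.iso_rep_isoClass)

/-! ### Coefficients of the two products -/

section coefficients

open RootedTreeOn IsoTree

variable (K : Type*) [Field K] {V : Type} [Finite V]

theorem natCast_card_subtype {ι : Type} [Fintype ι] (p : ι → Prop) [DecidablePred p] :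
    (Nat.card {i // p i} : K) = ∑ i, if p i then 1 else 0 := by
  rw [Nat.card_eq_fintype_card, Fintype.card_subtype, Finset.sum_boole]

/-- Being isomorphic to a representative is equality of classes, so each cut contributes a product
of two indicators. -/
theorem graft_apply_isoClass (a b : IsoTree) (x : RootedTreeOn V) :
    graft K a b x.isoClass = ∑ w : x.Edge, Finsupp.single a (1 : K)
      (x.branch w.1).toTree.isoClass * Finsupp.single b 1 (x.trunk w.1 w.2).toTree.isoClass := by
  classical
  change ((cutCount a.rep b.rep x.isoClass.rep : ℕ) : K) = _
  rw [← x.iso_rep_isoClass.cutCount_eq]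
  refine (natCast_card_subtype K (ι := x.Edge) _).trans (Finset.sum_congr rfl fun w _ => ?_)
  simp only [← isoClass_eq_iff, Finsupp.single_apply, ite_and, ite_mul, one_mul, zero_mul,
    eq_comm (a := a), eq_comm (a := b)]

theorem insertTree_apply_isoClass (a b : IsoTree) (x : RootedTreeOn V) :
    insertTree K a b x.isoClass = ∑ s : x.Subtree, Finsupp.single a (1 : K)
      s.toTree.isoClass * Finsupp.single b 1 s.contract.isoClass := by
  classical
  change ((subtreeCount a.rep b.rep x.isoClass.rep : ℕ) : K) = _
  rw [← x.iso_rep_isoClass.subtreeCount_eq]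
  refine (natCast_card_subtype K (ι := x.Subtree) _).trans (Finset.sum_congr rfl fun w _ => ?_)
  simp only [← isoClass_eq_iff, Finsupp.single_apply, ite_and, ite_mul, one_mul, zero_mul,
    eq_comm (a := a), eq_comm (a := b)]

/-- The coefficients of `u → v`, as sums over edges. -/
theorem grafting_apply_isoClass (u v : TreeSpace K) (x : RootedTreeOn V) :
    grafting K u v x.isoClass = ∑ w : x.Edge,
      u (x.branch w.1).toTree.isoClass * v (x.trunk w.1 w.2).toTree.isoClass := by
  induction u using Finsupp.induction_linear with
  | zero => simp
  | add u u' h h' => simp [h, h', add_mul, Finset.sum_add_distrib]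
  | single a c =>
    induction v using Finsupp.induction_linear with
    | zero => simp
    | add v v' h h' => simp only [map_add, Finsupp.add_apply, h, h', mul_add,
        Finset.sum_add_distrib]
    | single b d =>
      simp only [grafting, Finsupp.linearCombination_single, LinearMap.smul_apply,
        Finsupp.smul_apply, smul_eq_mul, graft_apply_isoClass, Finset.mul_sum]
      refine Finset.sum_congr rfl fun w _ => ?_
      -- Turns `single a c` into `c • single a 1`, so that the scalars factor out.
      rw [← mul_one c, ← mul_one d, ← smul_eq_mul c, ← smul_eq_mul d, ← Finsupp.smul_single,
        ← Finsupp.smul_single]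
      simp only [Finsupp.smul_apply, smul_eq_mul]
      ring

/-- The coefficients of `t ▷ u`, as sums over subtrees. -/
theorem insertion_apply_isoClass (t : EdgeTreeSpace K) (u : TreeSpace K) (x : RootedTreeOn V) :
    insertion K t u x.isoClass = ∑ s : x.Subtree,
      t.mapDomain Subtype.val s.toTree.isoClass * u s.contract.isoClass := by
  induction t using Finsupp.induction_linear with
  | zero => simp
  | add u u' h h' => simp [h, h', add_mul, Finset.sum_add_distrib, Finsupp.mapDomain_add]
  | single a c =>
    induction u using Finsupp.induction_linear with
    | zero => simp
    | add v v' h h' => simp only [map_add, Finsupp.add_apply, h, h', mul_add,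
        Finset.sum_add_distrib]
    | single b d =>
      simp only [insertion, Finsupp.linearCombination_single, LinearMap.smul_apply,
        Finsupp.smul_apply, smul_eq_mul, insertTree_apply_isoClass, Finset.mul_sum,
        Finsupp.mapDomain_single]
      refine Finset.sum_congr rfl fun w _ => ?_
      rw [← mul_one c, ← mul_one d, ← smul_eq_mul c, ← smul_eq_mul d, ← Finsupp.smul_single,
        ← Finsupp.smul_single]
      simp only [Finsupp.smul_apply, smul_eq_mul]
      ring

end coefficients

/-! ### Sums over pairs of a subtree and an edge -/

section pairs

open RootedTreeOn

variable {K : Type*} [Field K] {V : Type} [Finite V] {x : RootedTreeOn V}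

/-- Extension by zero gives the sums a common index set; the dependent `if` keeps the proof that the
summand requires. -/
theorem Fintype.sum_subtype_eq_sum_dite {ι M : Type*} [Fintype ι] [AddCommMonoid M]
    (p : ι → Prop) [DecidablePred p] [Fintype {i // p i}] (f : {i // p i} → M) :
    ∑ i, f i = ∑ i, if h : p i then f ⟨i, h⟩ else 0 := by
  rw [Finset.sum_dite, Finset.sum_const_zero, add_zero]
  exact Fintype.sum_equiv (Equiv.subtypeEquivRight (by simp)) _ _ fun _ => rfl

open Classical in
/-- A sum over the subtrees of a subtree `b`, as a sum over the subtrees of `x`. -/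
theorem RootedTreeOn.Subtree.sum_subtree (b : x.Subtree) (F : IsoTree → IsoTree → K) :
    ∑ s : b.toTree.Subtree, F s.toTree.isoClass s.contract.isoClass
      = ∑ s : x.Subtree, if h : s.carrier ⊆ b.carrier then
          F s.toTree.isoClass (b.restrict s h).contract.isoClass else 0 := by
  rw [← Fintype.sum_subtype_eq_sum_dite (fun s : x.Subtree => s.carrier ⊆ b.carrier)
    (fun s => F s.1.toTree.isoClass (b.restrict s.1 s.2).contract.isoClass)]
  refine (Fintype.sum_equiv b.restrictEquiv _ _ fun s => ?_).symm
  rw [← (b.restrict_toTree_iso s.1 s.2).isoClass_eq]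
  rfl

namespace RootedTreeOn

/-- The edges of `x / s` are the edges of `x` that are not in `s`. -/
def Subtree.contractEdgeEquiv (s : x.Subtree) :
    {w : x.Edge // w.1 ∈ s.carrier → w.1 = s.top} ≃ s.contract.Edge where
  toFun w := ⟨⟨w.1.1, w.2⟩, (s.ne_contract_root_iff _).2 w.1.2⟩
  invFun w := ⟨⟨w.1.1, (s.ne_contract_root_iff _).1 w.2⟩, w.1.2⟩
  left_inv _ := rfl
  right_inv _ := rfl

/-- For an edge of `x` not in the subtree `s`, the subtree lies in the branch or in the trunk,
and accordingly the cut of `x / s` at this edge has branch or trunk obtained by contracting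
`s`. -/
theorem sum_edge_contract (s : x.Subtree) (F : IsoTree → IsoTree → K) :
    ∑ w : s.contract.Edge, F (s.contract.branch w.1).toTree.isoClass
        (s.contract.trunk w.1 w.2).toTree.isoClass
      = ∑ w : x.Edge, open Classical in
        ((if h : s.carrier ⊆ (x.branch w.1).carrier then
          F ((x.branch w.1).restrict s h).contract.isoClass
            (x.trunk w.1 w.2).toTree.isoClass else 0)
        + if h : s.carrier ⊆ (x.trunk w.1 w.2).carrier then
          F (x.branch w.1).toTree.isoClass
            ((x.trunk w.1 w.2).restrict s h).contract.isoClass else 0) := by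
  classical
  rw [← Fintype.sum_equiv s.contractEdgeEquiv _ _ fun _ => rfl,
    Fintype.sum_subtype_eq_sum_dite]
  refine Finset.sum_congr rfl fun w _ => ?_
  have hcompl (v : V) : v ∈ (x.trunk w.1 w.2).carrier ↔ v ∉ (x.branch w.1).carrier := Iff.rfl
  -- If the top of `s` lies in the branch, so does all of `s`. Otherwise the condition `hw`, saying
  -- that the edge above `w` is not an edge of `s`, decides between the trunk and neither part.
  by_cases hb : s.top ∈ (x.branch w.1).carrier
  · have h1 : s.carrier ⊆ (x.branch w.1).carrier := fun v hv =>
      x.reach_trans (s.reach_top hv) hb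
    have h2 : ¬ s.carrier ⊆ (x.trunk w.1 w.2).carrier := fun h => h s.top_mem hb
    have hw : w.1 ∈ s.carrier → w.1 = s.top := fun h =>
      x.eq_of_reach_reach (s.reach_top h) hb
    rw [dif_pos h1, dif_neg h2, dif_pos hw, add_zero]
    congr 1
    · refine (Subtree.restrict_contract_iso _ s h1 _ (fun v => ?_) ?_).isoClass_eq
      · exact s.contract_reach_iff v _
      · exact (s.collapse_coe ⟨w.1, hw⟩).symm
    · refine (Subtree.disjoint_contract_iso _ s ?_ _ (fun v => ?_) ?_).isoClass_eq
      · exact Set.disjoint_left.2 fun v hv hv' => hv' (h1 hv)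
      · exact not_congr (s.contract_reach_iff v _)
      · rfl
  · have h1 : ¬ s.carrier ⊆ (x.branch w.1).carrier := fun h => hb (h s.top_mem)
    by_cases hw : w.1 ∈ s.carrier → w.1 = s.top
    · have h2 : s.carrier ⊆ (x.trunk w.1 w.2).carrier := by
        rintro v hv ⟨k, hk⟩
        -- When `w` is outside `s`, a path from `s` up to `w` must leave `s` through its top, which
        -- would put the top in the branch.
        by_cases hws : w.1 ∈ s.carrier
        · exact hb ⟨0, (hw hws).symm⟩
        · induction k generalizing v with
          | zero => exact hws (hk ▸ hv)
          | succ k ih =>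
            by_cases hv' : v = s.top
            · exact hb ⟨k + 1, hv' ▸ hk⟩
            · exact ih (s.parent_mem hv hv') hk
      rw [dif_neg h1, dif_pos h2, dif_pos hw, zero_add]
      congr 1
      · refine (Subtree.disjoint_contract_iso _ s ?_ _ (fun v => ?_) ?_).isoClass_eq
        · exact Set.disjoint_left.2 fun v hv hv' => h2 hv hv'
        · exact s.contract_reach_iff v _
        · exact (s.collapse_coe ⟨w.1, hw⟩).symm
      · refine (Subtree.restrict_contract_iso _ s h2 _ (fun v => ?_) ?_).isoClass_eq
        · exact not_congr (s.contract_reach_iff v _)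
        · rfl
    · have h2 : ¬ s.carrier ⊆ (x.trunk w.1 w.2).carrier := fun h => by
        push Not at hw
        exact h hw.1 ⟨0, rfl⟩
      rw [dif_neg h1, dif_neg h2, dif_neg hw, add_zero]

end RootedTreeOn

end pairs

theorem mainTheorem1 (K : Type*) [Field K] (t : EdgeTreeSpace K) (u v : TreeSpace K) :
    insertion K t (grafting K u v)
      = grafting K (insertion K t u) v + grafting K u (insertion K t v) := by
  classical
  ext i
  -- The coefficient formulas are stated at classes of concrete trees.
  rw [← i.isoClass_rep]
  rw [Finsupp.add_apply, insertion_apply_isoClass, grafting_apply_isoClass,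
    grafting_apply_isoClass]
  -- The formulas apply again to branches, trunks and contractions because they allow any finite
  -- vertex type.
  simp only [grafting_apply_isoClass, insertion_apply_isoClass]
  rw [← Finset.sum_add_distrib]
  simp only [RootedTreeOn.sum_edge_contract _ fun a b => u a * v b,
    RootedTreeOn.Subtree.sum_subtree _ fun a b => t.mapDomain Subtype.val a * u b,
    RootedTreeOn.Subtree.sum_subtree _ fun a b => t.mapDomain Subtype.val a * v b, Finset.mul_sum, Finset.sum_mul]
  rw [Finset.sum_comm]
  refine Finset.sum_congr rfl fun w _ => ?_
  rw [← Finset.sum_add_distrib]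
  refine Finset.sum_congr rfl fun s _ => ?_
  split_ifs <;> ring
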